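/- Let $\Gamma$ be a tree (possibly infinite, nonempty), each of whose edges $e$ is oriented, with initial vertex $\iota(e)$ and terminal vertex $\tau(e)$. Let $(\mathcal G,\Gamma)$ and $(\mathcal M,\Gamma)$ be graphs of groups over $\Gamma$, with vertex groups $G_v, M_v$ and edge groups $G_e, M_e$; each comes with injective homomorphisms from every edge group into the two adjacent vertex groups, written $\alpha^G_e\colon G_e\to G_{\iota(e)}$, $\omega^G_e\colon G_e\to G_{\tau(e)}$ and likewise $\alpha^M_e,\omega^M_e$. Let $G=\pi_1(\mathcal G,\Gamma)$ and $M=\pi_1(\mathcal M,\Gamma)$ be the fundamental groups: $\pi_1(\mathcal G,\Gamma)$ is the quotient of the free product of all the groups $G_v$ and the free group on letters $t_e$ (one for each edge $e$) by the relations $t_e\,\omega^G_e(g)\,t_e^{-1}=\alpha^G_e(g)$ for all edges $e$ and $g\in G_e$, and $t_e=1$ for all edges $e$ of the (unique) spanning tree $\Gamma$ of $\Gamma$; similarly for $\pi_1(\mathcal M,\Gamma)$. Suppose that for each vertex $v$ there is an injective homomorphism $\phi_v\colon M_v\to G_v$ such that, for each edge $e$ of $\Gamma$, $$\phi_{\iota(e)}^{-1}\bigl(\alpha^G_e(G_e)\bigr)=\alpha^M_e(M_e),\qquad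 \phi_{\tau(e)}^{-1}\bigl(\omega^G_e(G_e)\bigr)=\omega^M_e(M_e),$$ and such that $\phi_{\iota(e)}$ and $\phi_{\tau(e)}$ agree on $M_e$, that is, for every $m\in M_e$ there is $g\in G_e$ with $\phi_{\iota(e)}(\alpha^M_e(m))=\alpha^G_e(g)$ and $\phi_{\tau(e)}(\omega^M_e(m))=\omega^G_e(g)$. Then the $\phi_v$ induce an injective homomorphism $\phi\colon M\to G$: there is a unique homomorphism $\phi\colon M\to G$ such that, for every vertex $v$, the composite $M_v\to M\xrightarrow{\phi}G$ equals the composite $M_v\xrightarrow{\phi_v}G_v\to G$ (where $M_v\to M$ and $G_v\to G$ are the canonical homomorphisms), and this $\phi$ is injective. -/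

import Mathlib

/-- An oriented graph with vertex set `V` and edge set `E` (loops and multiple edges are allowed):
every edge `e` has an initial vertex `init e` and a terminal vertex `term e`. -/
structure OrientedGraph (V : Type*) (E : Type*) where
  /-- the initial vertex of an edge -/
  init : E → V
  /-- the terminal vertex of an edge -/
  term : E → V

namespace OrientedGraph

variable {V E : Type*} (Γ : OrientedGraph V E)

/-- The simple graph on `V` in which two distinct vertices are adjacent when some edge from the
set `T` joins them, in either direction. -/
def toSimpleGraph (T : Set E) : SimpleGraph V :=
  SimpleGraph.fromRel fun v w => ∃ e ∈ T, Γ.init e = v ∧ Γ.term e = w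

/-- The subgraph with all vertices of `Γ` and with edge set `T` is a tree: there are no loops and no
multiple edges in `T`, and the resulting simple graph is connected (so nonempty) and acyclic. -/
structure IsSpanningTree (T : Set E) : Prop where
  noLoops : ∀ e ∈ T, Γ.init e ≠ Γ.term e
  noMultipleEdges : ∀ e ∈ T, ∀ f ∈ T, s(Γ.init e, Γ.term e) = s(Γ.init f, Γ.term f) → e = f
  isTree : (Γ.toSimpleGraph T).IsTree

/-- The graph `Γ` is a tree. Its unique spanning tree is then the set of all edges. -/
def IsTree : Prop := Γ.IsSpanningTree Set.univ

end OrientedGraph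

/-- A graph of groups over the oriented graph `Γ`: a group for every vertex, a group for every edge,
and monomorphisms from each edge group to the vertex groups at the two ends of the edge. -/
structure GraphOfGroups {V E : Type*} (Γ : OrientedGraph V E) where
  /-- the vertex groups -/
  vertexGroup : V → Type*
  /-- the edge groups -/
  edgeGroup : E → Type*
  [vertexGroupGroup : ∀ v, Group (vertexGroup v)]
  [edgeGroupGroup : ∀ e, Group (edgeGroup e)]
  /-- the embedding of an edge group in the group of the initial vertex -/
  initMap : ∀ e, edgeGroup e →* vertexGroup (Γ.init e)
  /-- the embedding of an edge group in the group of the terminal vertex -/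
  termMap : ∀ e, edgeGroup e →* vertexGroup (Γ.term e)
  initMap_injective : ∀ e, Function.Injective (initMap e)
  termMap_injective : ∀ e, Function.Injective (termMap e)

namespace GraphOfGroups

attribute [instance] vertexGroupGroup edgeGroupGroup

variable {V E : Type*} {Γ : OrientedGraph V E} (𝒢 : GraphOfGroups Γ)

/-- The free product of all the vertex groups and of the free group on the stable letters `t_e`,
one for each edge `e`. -/
abbrev FreeProd : Type _ :=
  Monoid.Coprod (Monoid.CoprodI 𝒢.vertexGroup) (FreeGroup E)

/-- An element of a vertex group, in the free product. -/
def vertexElt (v : V) : 𝒢.vertexGroup v →* 𝒢.FreeProd :=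
  Monoid.Coprod.inl.comp Monoid.CoprodI.of

/-- The stable letter `t_e`, in the free product. -/
def stableLetter (e : E) : 𝒢.FreeProd :=
  Monoid.Coprod.inr (FreeGroup.of e)

/-- The relators of the fundamental group: `t_e * termMap e g * t_e⁻¹ = initMap e g` for all edges
`e` and `g` in the edge group of `e`, and `t_e = 1` for all edges `e` in `T`. -/
def relators (T : Set E) : Set 𝒢.FreeProd :=
  {r | ∃ (e : E) (g : 𝒢.edgeGroup e),
      r = 𝒢.stableLetter e * 𝒢.vertexElt (Γ.term e) (𝒢.termMap e g) * (𝒢.stableLetter e)⁻¹ *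
        (𝒢.vertexElt (Γ.init e) (𝒢.initMap e g))⁻¹} ∪
    {r | ∃ e ∈ T, r = 𝒢.stableLetter e}

/-- The fundamental group of a graph of groups with respect to a spanning tree, given by the set
`T` of its edges. -/
abbrev fundamentalGroup (T : Set E) : Type _ :=
  𝒢.FreeProd ⧸ Subgroup.normalClosure (𝒢.relators T)

/-- The canonical homomorphism from a vertex group to the fundamental group. -/
def ofVertex (T : Set E) (v : V) : 𝒢.vertexGroup v →* 𝒢.fundamentalGroup T :=
  (QuotientGroup.mk' (Subgroup.normalClosure (𝒢.relators T))).comp (𝒢.vertexElt v)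

end GraphOfGroups

/-!
The group `G` is made to act on a set that contains a copy of `M`, in such a way that `M` acts on
this copy through `φ` by left multiplication; then `φ` is visibly injective. No normal form theorem
is used.

As the stable letters are trivial in the fundamental group of a tree of groups, an action of `G` is
a family of actions of the groups `G_v` on one set that agree on the edge groups. Take a set `L`
that is large compared with `M` and with all `G_v`. For each vertex `v`, the free action of `M_v` on
`M` induces a free action of `G_v` on `L`, with a copy of `M` in `L` and with many further orbits
(`exists_extension`). For an edge `e`, the two resulting actions of `G_e` on `L` are free, and the
condition that `M_e` is the preimage of `G_e` says that both contain the same action of `G_e`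
generated by `M`; since there are equally many orbits outside of it, they are isomorphic by a
permutation of `L` that respects the copies of `M` (`exists_intertwiner`). Because `Γ` is a tree,
these permutations can be absorbed by conjugating the action of each `G_v`
(`OrientedGraph.IsTree.exists_potential`), after which the actions agree on all edge groups
(`GraphOfGroups.exists_extend_action`).

This needs `M_v` to act freely on `M`, that is, `M_v → M` to be injective. That follows from the same
construction, applied to `M` in place of `G` and to the empty set in place of `M`: it yields an
action of `M` on a nonempty set for which every `M_v` acts freely
(`GraphOfGroups.ofVertex_injective`).
-/

/-! ### Potentials on trees -/

/-- A map from the vertices of a tree `S` into a group exists with prescribed quotients along the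
edges: multiply the quotients along the path to a fixed root. -/
theorem SimpleGraph.IsTree.exists_potential {V : Type*} {S : SimpleGraph V} (hS : S.IsTree)
    {P : Type*} [Group P] (w : V → V → P) (hw : ∀ u v, S.Adj u v → w u v * w v u = 1) :
    ∃ ψ : V → P, ∀ u v, S.Adj u v → ψ u = w u v * ψ v := by
  classical
  obtain ⟨root⟩ := hS.connected.nonempty
  choose p hp hp' using fun u => hS.existsUnique_path u root
  let wt : ∀ {u}, S.Walk u root → P := fun q => (q.darts.map fun d => w d.fst d.snd).prod
  have wt_cons : ∀ {u v} (h : S.Adj u v) (q : S.Walk v root),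
      wt (.cons h q) = w u v * wt q := fun h q => by simp [wt]
  refine ⟨fun u => wt (p u), fun u v h => ?_⟩
  by_cases hu : u ∈ (p v).support
  · -- the path from `v` to the root passes through `u`, hence starts with the edge from `v` to `u`
    have h1 : (p v).takeUntil u hu = .cons h.symm .nil :=
      (hS.existsUnique_path v u).unique ((hp v).takeUntil hu) (by simp [h.ne'])
    have h2 : (p v).dropUntil u hu = p u := hp' u _ ((hp v).dropUntil hu)
    have h3 : p v = .cons h.symm (p u) := by
      rw [← (p v).take_spec hu, h1, h2]; simp
    change wt (p u) = w u v * wt (p v)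
    rw [h3, wt_cons, ← mul_assoc, hw u v h, one_mul]
  · have h3 : Walk.cons h (p v) = p u :=
      hp' u _ ((Walk.cons_isPath_iff h (p v)).2 ⟨hp v, hu⟩)
    change wt (p u) = w u v * wt (p v)
    rw [← h3, wt_cons]

namespace OrientedGraph

variable {V E : Type*} {Γ : OrientedGraph V E}

theorem IsTree.adj (hΓ : Γ.IsTree) (e : E) :
    (Γ.toSimpleGraph Set.univ).Adj (Γ.init e) (Γ.term e) :=
  ⟨hΓ.noLoops e trivial, Or.inl ⟨e, trivial, rfl, rfl⟩⟩

/-- Any group-valued function on the edges of a tree is the coboundary of a function on the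
vertices. -/
theorem IsTree.exists_potential (hΓ : Γ.IsTree) {P : Type*} [Group P] (c : E → P) :
    ∃ ψ : V → P, ∀ e, ψ (Γ.init e) = c e * ψ (Γ.term e) := by
  classical
  have inj : ∀ e f, s(Γ.init e, Γ.term e) = s(Γ.init f, Γ.term f) → e = f :=
    fun e f => hΓ.noMultipleEdges e trivial f trivial
  let w : V → V → P := fun u v =>
    if h : ∃ e, Γ.init e = u ∧ Γ.term e = v then c h.choose
    else if h : ∃ e, Γ.init e = v ∧ Γ.term e = u then (c h.choose)⁻¹ else 1
  have w_fwd : ∀ e, w (Γ.init e) (Γ.term e) = c e := fun e => by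
    have h : ∃ f, Γ.init f = Γ.init e ∧ Γ.term f = Γ.term e := ⟨e, rfl, rfl⟩
    have h' : h.choose = e := inj _ _ (by rw [h.choose_spec.1, h.choose_spec.2])
    simp only [w]
    rw [dif_pos h, h']
  have w_bwd : ∀ e, w (Γ.term e) (Γ.init e) = (c e)⁻¹ := fun e => by
    have h : ∃ f, Γ.init f = Γ.init e ∧ Γ.term f = Γ.term e := ⟨e, rfl, rfl⟩
    have h' : h.choose = e := inj _ _ (by rw [h.choose_spec.1, h.choose_spec.2])
    have hn : ¬ ∃ f, Γ.init f = Γ.term e ∧ Γ.term f = Γ.init e := by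
      rintro ⟨f, h1, h2⟩
      obtain rfl : f = e := inj _ _ (by rw [h1, h2, Sym2.eq_swap])
      exact hΓ.noLoops f trivial h1
    simp only [w]
    rw [dif_neg hn, dif_pos h, h']
  obtain ⟨ψ, hψ⟩ := hΓ.isTree.exists_potential w fun u v huv => by
    rcases huv.2 with ⟨e, -, rfl, rfl⟩ | ⟨e, -, rfl, rfl⟩ <;> simp [w_fwd, w_bwd]
  exact ⟨ψ, fun e => by rw [hψ _ _ (hΓ.adj e), w_fwd]⟩

/-- A function on the vertices of a tree that agrees at the two ends of every edge is constant. -/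
theorem IsTree.eq_of_forall_edge (hΓ : Γ.IsTree) {X : Type*} {F : V → X}
    (hF : ∀ e, F (Γ.init e) = F (Γ.term e)) (u v : V) : F u = F v := by
  obtain ⟨p⟩ := hΓ.isTree.connected.preconnected u v
  induction p with
  | nil => rfl
  | cons h _ ih =>
    rw [← ih]
    rcases h.2 with ⟨e, -, rfl, rfl⟩ | ⟨e, -, rfl, rfl⟩
    exacts [hF e, (hF e).symm]

end OrientedGraph

/-! ### Free permutation actions -/

/-- The homomorphism `σ` is a free action of `H` on `X`: only `1` has a fixed point. -/
def IsFreeAction {H X : Type*} [Group H] (σ : H →* Equiv.Perm X) : Prop :=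
  ∀ h x, σ h x = x → h = 1

/-- Two points are related when they lie in the same orbit of `σ`. -/
def orbitSetoid {H X : Type*} [Group H] (σ : H →* Equiv.Perm X) : Setoid X where
  r x x' := ∃ h, σ h x = x'
  iseqv := by
    refine ⟨fun x => ⟨1, by simp⟩, ?_, ?_⟩
    · rintro x _ ⟨h, rfl⟩
      exact ⟨h⁻¹, by simp⟩
    · rintro x _ _ ⟨h, rfl⟩ ⟨h', rfl⟩
      exact ⟨h' * h, by simp⟩

/-- The points `k l` represent distinct orbits of `σ`, none of which meets the range of `j`. -/
def IsSpareTransversal {H X N : Type*} [Group H] (σ : H →* Equiv.Perm X) (j : N → X)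
    (k : X → X) : Prop :=
  (∀ h l l', σ h (k l) = k l' → l = l') ∧ ∀ h l n, σ h (j n) ≠ k l

/-- A free action of `A` on `N` extends along an injection `A → B` to a free action of `B` on any
set `L` that is large enough: the action induced from `A` to `B` is `B × (N / A)`, which sits inside
`B × (N ⊕ L)`, and the points `(1, inr l)` provide the spare orbits. -/
theorem exists_extension {A B N L : Type*} [Group A] [Group B] (φ : A →* B)
    (hφ : Function.Injective φ) (ρ : A →* Equiv.Perm N) (hρ : IsFreeAction ρ)
    (ε : B × (N ⊕ L) ↪ L) :
    ∃ (σ : B →* Equiv.Perm L) (j : N → L) (k : L → L), IsFreeAction σ ∧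
      Function.Injective j ∧ (∀ a n, σ (φ a) (j n) = j (ρ a n)) ∧
      (∀ b n n', σ b (j n) = j n' → ∃ a, φ a = b) ∧ IsSpareTransversal σ j k := by
  classical
  obtain ⟨eq⟩ := Function.Embedding.antisymm ε
    ⟨fun l => ((1 : B), .inr l), fun l l' h => by simpa using h⟩
  let r : Setoid N := orbitSetoid ρ
  -- `s n` is the chosen point of the orbit of `n`, and `q n` is the element that moves it to `n`
  let s : N → N := fun n => (Quotient.mk r n).out
  have hs : ∀ n, ∃ a, ρ a (s n) = n := fun n => Quotient.mk_out (s := r) n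
  choose q hq using hs
  have hs' : ∀ a n, s (ρ a n) = s n := fun a n =>
    congrArg Quotient.out (Quotient.sound (s := r) ⟨a⁻¹, by simp⟩)
  have cancel : ∀ a b n, ρ a n = ρ b n → a = b := fun a b n h => by
    have := hρ (b⁻¹ * a) n (by rw [map_mul, Equiv.Perm.mul_apply, h]; simp)
    rw [inv_mul_eq_one] at this; exact this.symm
  have hq' : ∀ a n, q (ρ a n) = a * q n := fun a n => cancel _ _ (s n) (by
    rw [map_mul, Equiv.Perm.mul_apply, hq, ← hs' a n, hq])
  let σ : B →* Equiv.Perm L :=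
    { toFun := fun b => eq.permCongr ((Equiv.mulLeft b).prodCongr (Equiv.refl (N ⊕ L)))
      map_one' := by ext l; simp
      map_mul' := fun b b' => by ext l; simp [Prod.map] }
  have hσ : ∀ b x, σ b (eq x) = eq (b * x.1, x.2) := fun b x => by simp [σ, Prod.map]
  refine ⟨σ, fun n => eq (φ (q n), .inl (s n)), fun l => eq (1, .inr l), fun b x h => ?_,
    fun n n' h => ?_, fun a n => ?_, fun b n n' h => ?_, fun b l l' h => ?_, fun b l n => ?_⟩
  · obtain ⟨x, rfl⟩ := eq.surjective x
    simpa [hσ, Prod.ext_iff] using h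
  · simp only [EmbeddingLike.apply_eq_iff_eq, Prod.mk.injEq, Sum.inl.injEq] at h
    rw [← hq n, ← hq n', hφ h.1, h.2]
  · simp [hσ, hs', hq']
  · simp only [hσ, EmbeddingLike.apply_eq_iff_eq, Prod.mk.injEq] at h
    exact ⟨q n' * (q n)⁻¹, by simp [← h.1]⟩
  · simp only [hσ, EmbeddingLike.apply_eq_iff_eq, Prod.mk.injEq, Sum.inr.injEq] at h
    exact h.2
  · simp [hσ]

/-- Coordinates on a set with a free action of `H`: the orbits, which are copies of `H`, are indexed
by `Quotient r` if they meet the range of `j`, and by `X` otherwise. Up to equivariant bijection, the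
part off the range of `j` thus depends on `H` and `X` only. -/
theorem IsFreeAction.exists_coordinates {H X N : Type*} [Group H] {σ : H →* Equiv.Perm X}
    (hσ : IsFreeAction σ) (j : N → X) (r : Setoid N)
    (hr : ∀ n n', r n n' ↔ ∃ h, σ h (j n) = j n') {k : X → X} (hk : IsSpareTransversal σ j k) :
    ∃ Ψ : H × (Quotient r ⊕ X) ≃ X,
      (∀ h g i, σ h (Ψ (g, i)) = Ψ (h * g, i)) ∧ ∀ i, Ψ (1, .inl i) = j i.out := by
  classical
  let t : Setoid X := orbitSetoid σ
  have ht : ∀ x x', Quotient.mk t x = Quotient.mk t x' ↔ ∃ h, σ h x = x' :=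
    fun x x' => Quotient.eq (r := t)
  let O := {o : Quotient t // ∀ n, Quotient.mk t (j n) ≠ o}
  -- the spare orbits show that there are exactly as many orbits off the range of `j` as points
  obtain ⟨eq⟩ := Function.Embedding.antisymm
    (⟨fun o : O => o.1.out, fun o o' h => Subtype.ext (Quotient.out_injective h)⟩ : O ↪ X)
    ⟨fun x => ⟨Quotient.mk t (k x), fun n h => by
      obtain ⟨b, hb⟩ := (ht _ _).1 h
      exact hk.2 _ _ _ hb⟩, fun x x' h => by
      obtain ⟨b, hb⟩ := (ht _ _).1 (Subtype.ext_iff.1 h)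
      exact hk.1 _ _ _ hb⟩
  let s : Quotient r ⊕ X → X := Sum.elim (fun i => j i.out) fun x => (eq.symm x).1.out
  have hs : ∀ h i i', σ h (s i) = s i' → i = i' := by
    rintro h (i | x) (i' | x') hh
    · rw [← Quotient.out_eq i, ← Quotient.out_eq i']
      exact congrArg _ (Quotient.sound ((hr _ _).2 ⟨h, hh⟩))
    · refine absurd ((ht _ _).2 ⟨h, hh⟩) ?_
      simpa [s] using (eq.symm x').2 i.out
    · refine absurd ((ht _ _).2 ⟨h, hh⟩).symm ?_
      simpa [s] using (eq.symm x).2 i'.out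
    · have := (ht _ _).2 ⟨h, hh⟩
      simp only [s, Sum.elim_inr, Quotient.out_eq] at this
      rw [eq.symm.injective (Subtype.ext this)]
  have bij : Function.Bijective fun p : H × (Quotient r ⊕ X) => σ p.1 (s p.2) := by
    constructor
    · rintro ⟨g, i⟩ ⟨g', i'⟩ h
      have h' : σ (g'⁻¹ * g) (s i) = s i' := by
        rw [map_mul, Equiv.Perm.mul_apply, map_inv, Equiv.Perm.inv_eq_iff_eq]; exact h
      obtain rfl := hs _ _ _ h'
      have := hσ _ _ h'
      rw [inv_mul_eq_one] at this
      rw [this]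
    · intro x
      suffices ∃ i, Quotient.mk t (s i) = Quotient.mk t x by
        obtain ⟨i, hi⟩ := this
        obtain ⟨h, hh⟩ := (ht _ _).1 hi
        exact ⟨(h, i), hh⟩
      by_cases hx : ∃ n, Quotient.mk t (j n) = Quotient.mk t x
      · obtain ⟨n, hn⟩ := hx
        refine ⟨.inl (Quotient.mk r n), Eq.trans ((ht _ _).2 ?_) hn⟩
        exact (hr _ _).1 (Quotient.mk_out (s := r) n)
      · push Not at hx
        exact ⟨.inr (eq ⟨_, hx⟩), by simp [s]⟩
  refine ⟨Equiv.ofBijective _ bij, fun h g i => by simp, fun i => by simp [s]⟩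

/-- Two free actions of `H` on `X` with enough spare orbits are isomorphic, by an isomorphism that
extends a given isomorphism between the parts generated by `N`. -/
theorem exists_intertwiner {H X N : Type*} [Group H] {σ₁ σ₂ : H →* Equiv.Perm X}
    (h₁ : IsFreeAction σ₁) (h₂ : IsFreeAction σ₂) {j₁ j₂ : N → X} {k₁ k₂ : X → X}
    (hk₁ : IsSpareTransversal σ₁ j₁ k₁) (hk₂ : IsSpareTransversal σ₂ j₂ k₂)
    (hj : ∀ h n n', σ₁ h (j₁ n) = j₁ n' ↔ σ₂ h (j₂ n) = j₂ n') :
    ∃ f : Equiv.Perm X, (∀ n, f (j₁ n) = j₂ n) ∧ ∀ h, f * σ₁ h = σ₂ h * f := by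
  let r : Setoid N := (orbitSetoid σ₁).comap j₁
  obtain ⟨Ψ₁, hΨ₁, hi₁⟩ := h₁.exists_coordinates j₁ r (fun _ _ => Iff.rfl) hk₁
  obtain ⟨Ψ₂, hΨ₂, hi₂⟩ := h₂.exists_coordinates j₂ r
    (fun _ _ => exists_congr fun h => hj h _ _) hk₂
  have key : ∀ h x, (Ψ₁.symm.trans Ψ₂) (σ₁ h x) = σ₂ h ((Ψ₁.symm.trans Ψ₂) x) := fun h x => by
    obtain ⟨⟨g, i⟩, rfl⟩ := Ψ₁.surjective x
    simp [hΨ₁, hΨ₂]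
  refine ⟨Ψ₁.symm.trans Ψ₂, fun n => ?_, fun h => Equiv.ext fun x => key h x⟩
  obtain ⟨h, hh⟩ : ∃ h, σ₁ h (j₁ (Quotient.mk r n).out) = j₁ n := Quotient.mk_out (s := r) n
  rw [← hh, key, ← (hj _ _ _).1 hh, ← hi₁, ← hi₂]
  simp

/-! ### Homomorphisms from the fundamental group of a tree of groups -/

namespace GraphOfGroups

variable {V E : Type*} {Γ : OrientedGraph V E}

theorem mk_stableLetter (𝒢 : GraphOfGroups Γ) (e : E) :
    QuotientGroup.mk' (Subgroup.normalClosure (𝒢.relators Set.univ)) (𝒢.stableLetter e) = 1 :=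
  (QuotientGroup.eq_one_iff _).2 (Subgroup.subset_normalClosure (Or.inr ⟨e, trivial, rfl⟩))

theorem ofVertex_initMap (𝒢 : GraphOfGroups Γ) (e : E) (g : 𝒢.edgeGroup e) :
    𝒢.ofVertex Set.univ (Γ.init e) (𝒢.initMap e g) =
      𝒢.ofVertex Set.univ (Γ.term e) (𝒢.termMap e g) := by
  have h : QuotientGroup.mk' (Subgroup.normalClosure (𝒢.relators Set.univ)) _ = 1 :=
    (QuotientGroup.eq_one_iff _).2 (Subgroup.subset_normalClosure (Or.inl ⟨e, g, rfl⟩))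
  rw [map_mul, map_mul, map_mul, map_inv, map_inv, mk_stableLetter, one_mul, inv_one, mul_one,
    mul_inv_eq_one] at h
  exact h.symm

/-- Homomorphisms from the fundamental group of a tree of groups are determined on the vertex
groups, because the stable letters are trivial. -/
theorem hom_ext (𝒢 : GraphOfGroups Γ) {P : Type*} [Group P]
    {F F' : 𝒢.fundamentalGroup Set.univ →* P}
    (h : ∀ v, F.comp (𝒢.ofVertex Set.univ v) = F'.comp (𝒢.ofVertex Set.univ v)) : F = F' := by
  refine QuotientGroup.monoidHom_ext _ (Monoid.Coprod.hom_ext ?_ ?_)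
  · exact Monoid.CoprodI.ext_hom _ _ h
  · ext e
    exact (congrArg F (𝒢.mk_stableLetter e)).trans
      ((map_one F).trans ((map_one F').symm.trans (congrArg F' (𝒢.mk_stableLetter e)).symm))

/-- The universal property of the fundamental group of a tree of groups: it is the colimit of the
vertex groups and edge groups. -/
theorem exists_lift (𝒢 : GraphOfGroups Γ) {P : Type*} [Group P] (f : ∀ v, 𝒢.vertexGroup v →* P)
    (hf : ∀ e g, f (Γ.init e) (𝒢.initMap e g) = f (Γ.term e) (𝒢.termMap e g)) :
    ∃ F : 𝒢.fundamentalGroup Set.univ →* P, ∀ v, F.comp (𝒢.ofVertex Set.univ v) = f v := by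
  let F₀ : 𝒢.FreeProd →* P := Monoid.Coprod.lift (Monoid.CoprodI.lift f) 1
  have hv : ∀ v g, F₀ (𝒢.vertexElt v g) = f v g := fun v g => by simp [F₀, vertexElt]
  have ht : ∀ e, F₀ (𝒢.stableLetter e) = 1 := fun e => by simp [F₀, stableLetter]
  have hker : Subgroup.normalClosure (𝒢.relators Set.univ) ≤ F₀.ker := by
    refine Subgroup.normalClosure_le_normal ?_
    rintro _ (⟨e, g, rfl⟩ | ⟨e, -, rfl⟩)
    · simp [MonoidHom.mem_ker, hv, ht, hf]
    · exact ht e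
  exact ⟨QuotientGroup.lift _ F₀ hker, fun v => MonoidHom.ext fun g => hv v g⟩

/-- The vertex groups generate the fundamental group of a tree of groups. -/
theorem eq_top_of_ofVertex_mem (𝒢 : GraphOfGroups Γ) (S : Subgroup (𝒢.fundamentalGroup Set.univ))
    (hS : ∀ v g, 𝒢.ofVertex Set.univ v g ∈ S) : S = ⊤ := by
  obtain ⟨F, hF⟩ := 𝒢.exists_lift (fun v => (𝒢.ofVertex Set.univ v).codRestrict S (hS v))
    fun e g => Subtype.ext (𝒢.ofVertex_initMap e g)
  have h : S.subtype.comp F = MonoidHom.id _ := 𝒢.hom_ext fun v => by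
    rw [MonoidHom.comp_assoc, hF]; rfl
  refine (Subgroup.eq_top_iff' S).2 fun x => ?_
  have hx : (F x : 𝒢.fundamentalGroup Set.univ) = x := DFunLike.congr_fun h x
  exact hx ▸ (F x).2

/-! ### Extending actions over a tree of groups -/

/-- Free actions of the groups `M_v` on a set `N`, compatible along the edges, extend to such
actions of the groups `G_v` on a larger set. -/
theorem exists_extend_action (hΓ : Γ.IsTree) (𝒢 ℳ : GraphOfGroups Γ)
    (φ : ∀ v, ℳ.vertexGroup v →* 𝒢.vertexGroup v)
    (hφ : ∀ v, Function.Injective (φ v))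
    (hinit : ∀ e, (𝒢.initMap e).range.comap (φ (Γ.init e)) = (ℳ.initMap e).range)
    (hterm : ∀ e, (𝒢.termMap e).range.comap (φ (Γ.term e)) = (ℳ.termMap e).range)
    (hagree : ∀ e (m : ℳ.edgeGroup e), ∃ g : 𝒢.edgeGroup e,
      φ (Γ.init e) (ℳ.initMap e m) = 𝒢.initMap e g ∧
      φ (Γ.term e) (ℳ.termMap e m) = 𝒢.termMap e g)
    {N : Type*} (ρ : ∀ v, ℳ.vertexGroup v →* Equiv.Perm N) (hρ : ∀ v, IsFreeAction (ρ v))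
    (hρe : ∀ e m, ρ (Γ.init e) (ℳ.initMap e m) = ρ (Γ.term e) (ℳ.termMap e m)) :
    ∃ (σ : ∀ v, 𝒢.vertexGroup v →* Equiv.Perm (List ((Σ v, 𝒢.vertexGroup v) ⊕ N)))
      (j : N → List ((Σ v, 𝒢.vertexGroup v) ⊕ N)),
      Function.Injective j ∧ (∀ v, IsFreeAction (σ v)) ∧
      (∀ e g, σ (Γ.init e) (𝒢.initMap e g) = σ (Γ.term e) (𝒢.termMap e g)) ∧
      ∀ v a n, σ v (φ v a) (j n) = j (ρ v a n) := by
  -- words in the elements of all the groups and of `N` absorb every `G_v × (N ⊕ L)`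
  let L := List ((Σ v, 𝒢.vertexGroup v) ⊕ N)
  let ε : ∀ v, 𝒢.vertexGroup v × (N ⊕ L) ↪ L := fun v =>
    ⟨fun x => x.2.elim (fun n => [.inl ⟨v, x.1⟩, .inr n])
        fun l => .inl ⟨v, x.1⟩ :: .inl ⟨v, 1⟩ :: l, by
      rintro ⟨g, n | l⟩ ⟨g', n' | l'⟩ h <;> simp_all [L]⟩
  choose σ j k hfree hj hjρ hjφ hk using fun v =>
    exists_extension (φ v) (hφ v) (ρ v) (hρ v) (ε v)
  -- an element of an edge group that moves a point of `N` into `N` comes from the edge group of `ℳ`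
  have stab : ∀ (v : V) {A B : Type _} [Group A] [Group B] (α : A →* ℳ.vertexGroup v)
      (β : B →* 𝒢.vertexGroup v), β.range.comap (φ v) = α.range → ∀ b n n',
      σ v (β b) (j v n) = j v n' ↔ ∃ m, φ v (α m) = β b ∧ ρ v (α m) n = n' := by
    refine fun v A B _ _ α β hαβ b n n' => ⟨fun H => ?_, ?_⟩
    · obtain ⟨a, ha⟩ := hjφ v _ _ _ H
      obtain ⟨m, rfl⟩ : a ∈ α.range := hαβ ▸ ⟨b, ha.symm⟩
      exact ⟨m, ha, hj v (by rw [← hjρ, ha, H])⟩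
    · rintro ⟨m, hm, rfl⟩
      rw [← hm, hjρ]
  have hit : ∀ e h m, φ (Γ.term e) (ℳ.termMap e m) = 𝒢.termMap e h ↔
      φ (Γ.init e) (ℳ.initMap e m) = 𝒢.initMap e h := fun e h m => by
    obtain ⟨g, hg, hg'⟩ := hagree e m
    rw [hg, hg', (𝒢.termMap_injective e).eq_iff, (𝒢.initMap_injective e).eq_iff]
  have edge : ∀ e, ∃ f : Equiv.Perm L, (∀ n, f (j (Γ.term e) n) = j (Γ.init e) n) ∧
      ∀ h, f * σ (Γ.term e) (𝒢.termMap e h) = σ (Γ.init e) (𝒢.initMap e h) * f := fun e =>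
    exists_intertwiner (σ₁ := (σ (Γ.term e)).comp (𝒢.termMap e))
      (σ₂ := (σ (Γ.init e)).comp (𝒢.initMap e))
      (fun h x hx => 𝒢.termMap_injective e ((hfree _ _ _ hx).trans (map_one _).symm))
      (fun h x hx => 𝒢.initMap_injective e ((hfree _ _ _ hx).trans (map_one _).symm))
      ⟨fun h => (hk _).1 _, fun h => (hk _).2 _⟩ ⟨fun h => (hk _).1 _, fun h => (hk _).2 _⟩
      fun h n n' => by
        refine (stab _ _ _ (hterm e) h n n').trans
          (Iff.trans (exists_congr fun m => ?_) (stab _ _ _ (hinit e) h n n').symm)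
        rw [hit, hρe]
  choose f hfj hfσ using edge
  obtain ⟨ψ, hψ⟩ := hΓ.exists_potential f
  obtain ⟨v₀⟩ := hΓ.isTree.connected.nonempty
  -- the embeddings of `N` agree once all the actions are transported along `ψ`
  have hjψ : ∀ v n, (ψ v)⁻¹ (j v n) = (ψ v₀)⁻¹ (j v₀ n) := fun v n =>
    hΓ.eq_of_forall_edge (F := fun v => (ψ v)⁻¹ (j v n)) (fun e => by
      simp only [hψ e, mul_inv_rev, Equiv.Perm.mul_apply, ← hfj e]
      simp) v v₀
  refine ⟨fun v => (MulAut.conj (ψ v)⁻¹).toMonoidHom.comp (σ v),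
    fun n => (ψ v₀)⁻¹ (j v₀ n), (ψ v₀)⁻¹.injective.comp (hj v₀), fun v h x hx => ?_,
    fun e g => ?_, fun v a n => ?_⟩
  · refine hfree v h (ψ v x) ?_
    have : (ψ v)⁻¹ (σ v h (ψ v x)) = x := by simpa using hx
    rwa [Equiv.Perm.inv_eq_iff_eq, eq_comm, eq_comm] at this
  · have h1 : σ (Γ.init e) (𝒢.initMap e g) = f e * σ (Γ.term e) (𝒢.termMap e g) * (f e)⁻¹ := by
      rw [hfσ, mul_inv_cancel_right]
    simp only [MonoidHom.comp_apply, MulEquiv.coe_toMonoidHom, MulAut.conj_apply, hψ, h1]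
    group
  · simp only [← hjψ v, ← hjρ]
    simp

/-- The vertex groups of a tree of groups embed in its fundamental group, as they act freely on a
nonempty set on which the fundamental group acts. -/
theorem ofVertex_injective (hΓ : Γ.IsTree) (𝒢 : GraphOfGroups Γ) (v : V) :
    Function.Injective (𝒢.ofVertex Set.univ v) := by
  obtain ⟨σ, -, -, hfree, hσ, -⟩ := exists_extend_action hΓ 𝒢 𝒢
    (fun v => MonoidHom.id _) (fun _ _ _ h => h) (fun _ => rfl) (fun _ => rfl)
    (fun e m => ⟨m, rfl, rfl⟩) (N := PEmpty.{1}) (fun _ => 1) (fun _ _ n => n.elim) (fun _ _ => rfl)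
  obtain ⟨F, hF⟩ := 𝒢.exists_lift σ hσ
  rw [injective_iff_map_eq_one]
  intro g hg
  refine hfree v g [] ?_
  rw [← hF v, MonoidHom.comp_apply, hg, map_one, Equiv.Perm.one_apply]

end GraphOfGroups

theorem lemma3p1 {V E : Type*} (Γ : OrientedGraph V E) (hΓ : Γ.IsTree)
    (𝒢 ℳ : GraphOfGroups Γ)
    (φ : ∀ v, ℳ.vertexGroup v →* 𝒢.vertexGroup v)
    (hφ : ∀ v, Function.Injective (φ v))
    (hinit : ∀ e, (𝒢.initMap e).range.comap (φ (Γ.init e)) = (ℳ.initMap e).range)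
    (hterm : ∀ e, (𝒢.termMap e).range.comap (φ (Γ.term e)) = (ℳ.termMap e).range)
    (hagree : ∀ e (m : ℳ.edgeGroup e), ∃ g : 𝒢.edgeGroup e,
      φ (Γ.init e) (ℳ.initMap e m) = 𝒢.initMap e g ∧
      φ (Γ.term e) (ℳ.termMap e m) = 𝒢.termMap e g) :
    ∃ Φ : ℳ.fundamentalGroup Set.univ →* 𝒢.fundamentalGroup Set.univ,
      (∀ v, Φ.comp (ℳ.ofVertex Set.univ v) = (𝒢.ofVertex Set.univ v).comp (φ v)) ∧
      (∀ Ψ : ℳ.fundamentalGroup Set.univ →* 𝒢.fundamentalGroup Set.univ,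
        (∀ v, Ψ.comp (ℳ.ofVertex Set.univ v) = (𝒢.ofVertex Set.univ v).comp (φ v)) → Ψ = Φ) ∧
      Function.Injective Φ := by
  obtain ⟨Φ, hΦ⟩ := ℳ.exists_lift (fun v => (𝒢.ofVertex Set.univ v).comp (φ v)) fun e m => by
    obtain ⟨g, hg, hg'⟩ := hagree e m
    simp only [MonoidHom.comp_apply, hg, hg', 𝒢.ofVertex_initMap]
  refine ⟨Φ, hΦ, fun Ψ hΨ => ℳ.hom_ext fun v => (hΨ v).trans (hΦ v).symm, ?_⟩
  -- the action of `M` on itself by left multiplication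
  let lam : ℳ.fundamentalGroup Set.univ →* Equiv.Perm (ℳ.fundamentalGroup Set.univ) :=
    MulAction.toPermHom _ _
  obtain ⟨σ, j, hj, -, hσ, hσj⟩ := GraphOfGroups.exists_extend_action hΓ 𝒢 ℳ φ hφ hinit
    hterm hagree (fun v => lam.comp (ℳ.ofVertex Set.univ v))
    (fun v a n h => GraphOfGroups.ofVertex_injective hΓ ℳ v <| by
      rw [map_one]; exact mul_eq_right.1 h)
    (fun e m => by rw [MonoidHom.comp_apply, MonoidHom.comp_apply, ℳ.ofVertex_initMap])
  obtain ⟨F, hF⟩ := 𝒢.exists_lift σ hσ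
  -- `M` acts through `Φ` on the copy of `M` by left multiplication, as its vertex groups do
  let S : Subgroup (ℳ.fundamentalGroup Set.univ) :=
    { carrier := {x | ∀ n, F (Φ x) (j n) = j (x * n)}
      one_mem' := fun n => by simp
      mul_mem' := fun {x y} hx hy n => by
        rw [map_mul, map_mul, Equiv.Perm.mul_apply, hy, hx, mul_assoc]
      inv_mem' := fun {x} hx n => by
        rw [map_inv, map_inv, Equiv.Perm.inv_eq_iff_eq, hx, mul_inv_cancel_left] }
  have hS : S = ⊤ := ℳ.eq_top_of_ofVertex_mem S fun v a n => by
    have h1 : Φ (ℳ.ofVertex Set.univ v a) = 𝒢.ofVertex Set.univ v (φ v a) :=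
      DFunLike.congr_fun (hΦ v) a
    have h2 : F (𝒢.ofVertex Set.univ v (φ v a)) = σ v (φ v a) := DFunLike.congr_fun (hF v) _
    rw [h1, h2, hσj]
    rfl
  have key : ∀ x n, F (Φ x) (j n) = j (x * n) := fun x => hS.ge (Subgroup.mem_top x)
  rw [injective_iff_map_eq_one]
  intro x hx
  have := key x 1
  rw [hx, map_one, Equiv.Perm.one_apply, mul_one] at this
  exact (hj this).symm
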